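/- Let $k\ge 2$ be a fixed integer. A $k$-DFAO $M$ is a deterministic finite automaton with input alphabet $\{0,1,\dots,k-1\}$ in which an output letter is attached to each state; it generates the $k$-automatic sequence $\mathbf{x}_M=(a(n))_{n\ge 0}$, where $a(n)$ is the output of the state reached from the start state after reading the canonical base-$k$ representation of $n$ (most significant digit first, no leading zeros). A factor of an infinite word is a finite block of consecutive letters of it. An infinite word is recurrent if each of its factors occurs in it infinitely often, and uniformly recurrent if each of its factors occurs in it infinitely often with bounded gaps between consecutive occurrences. Automata are given to algorithms by an explicit finite description (start state, transition table, output table). Theorem. The following four problems are decidable (that is, each is solved by an algorithm that halts on every input). 1. Given a $k$-DFAO $M$, is $\mathbf{x}_M$ recurrent? 2. Given a $k$-DFAO $M$, is $\mathbf{x}_M$ uniformly recurrent? 3. Given two $k$-DFAOs $M$ and $M'$, do $\mathbf{x}_M$ and $\mathbf{x}_{M'}$ have the same set of factors? 4. Given two $k$-DFAOs $M$ and $M'$, is the set of factors of $\mathbf{x}_M$ contained in the set of factors of $\mathbf{x}_{M'}$? -/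

import Mathlib

/-- A deterministic finite automaton with output: input alphabet `Σ_k = Fin k`, finitely many
states `Fin numStates`, and an output letter in `Δ` attached to each state. -/
structure DFAO (k : ℕ) (Δ : Type*) where
  numStates : ℕ
  start : Fin numStates
  step : Fin numStates → Fin k → Fin numStates
  output : Fin numStates → Δ

namespace DFAO

variable {k : ℕ} {Δ : Type*}

/-- The explicit finite description of an automaton: the index of the start state, and the table
which lists for each state its output letter and the indices of its successors. -/
def description (M : DFAO k Δ) : ℕ × List (Δ × (Fin k → ℕ)) :=
  (M.start, List.ofFn fun q => (M.output q, fun d => (M.step q d : ℕ)))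

/-- A start index and a table describe an automaton if all indices are within range. -/
def Valid (c : ℕ × List (Δ × (Fin k → ℕ))) : Prop :=
  c.1 < c.2.length ∧ ∀ row ∈ c.2, ∀ d, row.2 d < c.2.length

instance (c : ℕ × List (Δ × (Fin k → ℕ))) : Decidable (Valid c) :=
  inferInstanceAs (Decidable (_ ∧ _))

/-- The automaton with a given valid description. -/
def ofDescription (c : ℕ × List (Δ × (Fin k → ℕ))) (h : Valid c) : DFAO k Δ where
  numStates := c.2.length
  start := ⟨c.1, h.1⟩
  step q d := ⟨(c.2.get q).2 d, h.2 _ (List.get_mem _ _) d⟩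
  output q := (c.2.get q).1

theorem description_valid (M : DFAO k Δ) : Valid M.description := by
  refine ⟨by simp [description], ?_⟩
  intro row hrow d
  simp only [description, List.mem_ofFn'] at hrow
  obtain ⟨q, rfl⟩ := hrow
  simp [description]

theorem description_ofDescription (c : ℕ × List (Δ × (Fin k → ℕ))) (h : Valid c) :
    (ofDescription c h).description = c := by
  refine Prod.ext rfl ?_
  exact List.ofFn_get c.2

theorem description_injective : Function.Injective (description (k := k) (Δ := Δ)) := by
  rintro ⟨n, s, f, g⟩ ⟨n', s', f', g'⟩ h
  simp only [description, Prod.mk.injEq] at h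
  obtain ⟨h1, h2⟩ := h
  obtain rfl : n = n' := by simpa using congrArg List.length h2
  have h3 := List.ofFn_injective h2
  obtain rfl : s = s' := Fin.ext h1
  obtain rfl : f = f' := by
    funext q d
    exact Fin.ext (congrFun (congrArg Prod.snd (congrFun h3 q)) d)
  obtain rfl : g = g' := by
    funext q
    exact congrArg Prod.fst (congrFun h3 q)
  rfl

/-- Automata correspond exactly to valid descriptions. -/
def equivDescription : DFAO k Δ ≃ {c : ℕ × List (Δ × (Fin k → ℕ)) // Valid c} where
  toFun M := ⟨M.description, M.description_valid⟩
  invFun c := ofDescription c.1 c.2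
  left_inv _ := description_injective (description_ofDescription _ _)
  right_inv _ := Subtype.ext (description_ofDescription _ _)

theorem primrecPred_valid [Primcodable Δ] :
    PrimrecPred (Valid : ℕ × List (Δ × (Fin k → ℕ)) → Prop) := by
  have hR : PrimrecRel fun (d : Fin k) (x : (Δ × (Fin k → ℕ)) × ℕ) => x.1.2 d < x.2 :=
    Primrec.nat_lt.comp
      (Primrec.fin_app.comp (Primrec.snd.comp (Primrec.fst.comp Primrec.snd)) Primrec.fst)
      (Primrec.snd.comp Primrec.snd)
  have hrow : PrimrecRel fun (row : Δ × (Fin k → ℕ)) (n : ℕ) => ∀ d, row.2 d < n :=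
    ((hR.forall_mem_list.comp (Primrec.const (List.finRange k)) Primrec.id).of_eq
      fun x => by simp)
  exact (Primrec.nat_lt.comp Primrec.fst (Primrec.list_length.comp Primrec.snd)).and
    (hrow.forall_mem_list.comp Primrec.snd (Primrec.list_length.comp Primrec.snd))

/-- Automata are given to an algorithm through their explicit finite descriptions. -/
instance [Primcodable Δ] : Primcodable (DFAO k Δ) :=
  letI : Primcodable {c : ℕ × List (Δ × (Fin k → ℕ)) // Valid c} :=
    Primcodable.subtype primrecPred_valid
  Primcodable.ofEquiv _ equivDescription

/-- The state reached from the start state after reading a word. -/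
def run (M : DFAO k Δ) (w : List (Fin k)) : Fin M.numStates :=
  w.foldl M.step M.start

end DFAO

/-- The canonical base-`k` representation `(n)_k`: most significant digit first, no leading zeros
(so that `0` is represented by the empty word). -/
def canonicalRep (k : ℕ) [NeZero k] (n : ℕ) : List (Fin k) :=
  ((Nat.digits k n).map (Fin.ofNat k)).reverse

/-- The `k`-automatic sequence generated by an automaton: its `n`-th letter is the output of the
last state reached on the base-`k` representation of `n`. -/
def DFAO.sequence {k : ℕ} [NeZero k] {Δ : Type*} (M : DFAO k Δ) (n : ℕ) : Δ :=
  M.output (M.run (canonicalRep k n))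

/-- The factor `a[i..i+n-1]` of length `n` beginning at position `i`. -/
def factorAt {Δ : Type*} (a : ℕ → Δ) (i n : ℕ) : List Δ :=
  (List.range n).map fun t => a (i + t)

/-- The set of (finite) factors of an infinite word. -/
def factorSet {Δ : Type*} (a : ℕ → Δ) : Set (List Δ) :=
  {w | ∃ i n, factorAt a i n = w}

/-- The positions at which the word `w` occurs in `a`. -/
def occurrences {Δ : Type*} (a : ℕ → Δ) (w : List Δ) : Set ℕ :=
  {i | factorAt a i w.length = w}

/-- Every factor (a word occurring at least once) occurs infinitely often. -/
def IsRecurrent {Δ : Type*} (a : ℕ → Δ) : Prop :=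
  ∀ w ∈ factorSet a, (occurrences a w).Infinite

/-- Every factor occurs infinitely often, with bounded gaps between consecutive occurrences. -/
def IsUniformlyRecurrent {Δ : Type*} (a : ℕ → Δ) : Prop :=
  ∀ w ∈ factorSet a, (occurrences a w).Infinite ∧
    ∃ t : ℕ, ∀ i ∈ occurrences a w, ∀ j ∈ occurrences a w, i < j →
      (∀ m ∈ occurrences a w, ¬ (i < m ∧ m < j)) → j - i ≤ t

/-!
Each of the four properties is a first-order sentence about addition, order and the letters of the
sequences, and the atomic formulas of this logic are recognized by automata reading the digits of
all variables in parallel. Recognizable predicates are closed under the logical operations, with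
computable bounds on the number of states. If a predicate recognized with `c` states holds for some
`y` at `x`, then it holds for such a `y` with at most `c` digits more than the longest entry of `x`.
Hence every quantifier can be bounded primitive recursively, and the sentences are decided by
bounded search, without constructing any of the automata.
-/

/-- `F` is the state map of an automaton reading the base-`k` digits of all its arguments in
parallel, most significant digits first: the state after one more digit depends only on the state
before it. Leaving the transition function implicit makes the state on a tuple independent of
leading zeros. -/
def DigitInvariant (k : ℕ) {r : ℕ} {S : Type*} (F : (Fin r → ℕ) → S) : Prop :=
  ∀ d : Fin r → ℕ, (∀ v, d v < k) → Function.FactorsThrough (fun x => F (k • x + d)) F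

namespace DigitInvariant

variable {k r : ℕ} {S T : Type*}

theorem prodMk {F : (Fin r → ℕ) → S} {G : (Fin r → ℕ) → T} (hF : DigitInvariant k F)
    (hG : DigitInvariant k G) : DigitInvariant k fun x => (F x, G x) := fun d hd _ _ h =>
  Prod.ext (hF d hd (congrArg Prod.fst h)) (hG d hd (congrArg Prod.snd h))

theorem pow {F : (Fin r → ℕ) → S} (hk : 0 < k) (hF : DigitInvariant k F) (m : ℕ) :
    DigitInvariant (k ^ m) F := by
  induction m with
  | zero =>
    intro d hd x y h
    obtain rfl : d = 0 := funext fun v => by simpa using hd v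
    simpa using h
  | succ m ih =>
    intro d hd x y h
    have split_digit : ∀ x : Fin r → ℕ,
        k ^ (m + 1) • x + d = k • (k ^ m • x + fun v => d v / k) + fun v => d v % k := fun x => by
      ext v
      simp only [Pi.add_apply, Pi.smul_apply, smul_eq_mul, mul_add, add_assoc, Nat.div_add_mod,
        pow_succ', mul_assoc]
    simp only [split_digit]
    exact hF _ (fun v => Nat.mod_lt _ hk)
      (ih _ (fun v => Nat.div_lt_of_lt_mul (by simpa only [pow_succ'] using hd v)) h)

theorem cons_mul_add {F : (Fin (r + 1) → ℕ) → S} (hF : DigitInvariant k F) {y y' e : ℕ}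
    {x x' d : Fin r → ℕ} (he : e < k) (hd : ∀ v, d v < k)
    (h : F (Matrix.vecCons y x) = F (Matrix.vecCons y' x')) :
    F (Matrix.vecCons (k * y + e) (k • x + d)) = F (Matrix.vecCons (k * y' + e) (k • x' + d)) := by
  simpa using hF (Matrix.vecCons e d) (Fin.cases he hd) h

theorem range {F : (Fin (r + 1) → ℕ) → S} (hk : 0 < k) (hF : DigitInvariant k F) :
    DigitInvariant k fun x => Set.range fun y => F (Matrix.vecCons y x) := by
  have range_subset : ∀ x x' d : Fin r → ℕ, (∀ v, d v < k) →
      (Set.range fun y => F (Matrix.vecCons y x)) ⊆ (Set.range fun y => F (Matrix.vecCons y x')) →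
      (Set.range fun y => F (Matrix.vecCons y (k • x + d))) ⊆
        Set.range fun y => F (Matrix.vecCons y (k • x' + d)) := by
    rintro x x' d hd h _ ⟨y, rfl⟩
    obtain ⟨y', hy'⟩ := h ⟨y / k, rfl⟩
    exact ⟨k * y' + y % k, by
      simpa only [Nat.div_add_mod] using hF.cons_mul_add (Nat.mod_lt y hk) hd hy'⟩
  exact fun d hd x x' h =>
    (range_subset x x' d hd h.subset).antisymm (range_subset x' x d hd h.superset)

/-- Pumping: the prefixes of `y` longer than all digits of `x` cannot all lead to different states,
and cutting out the digits between two that agree makes `y` smaller. -/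
theorem exists_lt_of_pow_add_card_le [Finite S] {F : (Fin (r + 1) → ℕ) → S} (hk : 2 ≤ k)
    (hF : DigitInvariant k F) {L y : ℕ} {x : Fin r → ℕ} (hx : ∀ v, x v < k ^ L)
    (hy : k ^ (L + Nat.card S) ≤ y) :
    ∃ y' < y, F (Matrix.vecCons y' x) = F (Matrix.vecCons y x) := by
  have hk0 : 0 < k := by omega
  obtain ⟨i, j, hij, hprefix⟩ : ∃ i j : Fin (Nat.card S + 1), i < j ∧
      F (Matrix.vecCons (y / k ^ (L + j)) 0) = F (Matrix.vecCons (y / k ^ (L + i)) 0) := by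
    have := Fintype.ofFinite S
    obtain ⟨i, j, hij, h⟩ := Fintype.exists_ne_map_eq_of_card_lt
      (fun i : Fin (Nat.card S + 1) => F (Matrix.vecCons (y / k ^ (L + i)) 0))
      (by simp [Nat.card_eq_fintype_card])
    rcases hij.lt_or_gt with hij | hij
    exacts [⟨i, j, hij, h.symm⟩, ⟨j, i, hij, h⟩]
  have hpos : 0 < k ^ (L + i) := Nat.pow_pos hk0
  have hlt : y / k ^ (L + j) < y / k ^ (L + i) := by
    have hprefix_pos : 0 < y / k ^ (L + i) :=
      Nat.div_pos ((Nat.pow_le_pow_right hk0 (by omega)).trans hy) hpos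
    rw [← Nat.add_sub_of_le (show L + (i : ℕ) ≤ L + j by omega), pow_add,
      ← Nat.div_div_eq_div_mul]
    exact Nat.div_lt_self hprefix_pos (Nat.one_lt_pow (by omega) hk)
  refine ⟨k ^ (L + i) * (y / k ^ (L + j)) + y % k ^ (L + i), ?_, ?_⟩
  · calc _ < k ^ (L + i) * (y / k ^ (L + i)) + y % k ^ (L + i) := by gcongr
      _ = y := Nat.div_add_mod y _
  · simpa [Nat.div_add_mod] using (hF.pow hk0 (L + i)).cons_mul_add (Nat.mod_lt y hpos)
      (fun v => (hx v).trans_le (Nat.pow_le_pow_right hk0 (Nat.le_add_right L i))) hprefix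

theorem exists_lt_pow_add_card [Finite S] {F : (Fin (r + 1) → ℕ) → S} (hk : 2 ≤ k)
    (hF : DigitInvariant k F) {L : ℕ} {x : Fin r → ℕ} (hx : ∀ v, x v < k ^ L) (y : ℕ) :
    ∃ y' < k ^ (L + Nat.card S), F (Matrix.vecCons y' x) = F (Matrix.vecCons y x) := by
  induction y using Nat.strong_induction_on with
  | _ y ih =>
    rcases lt_or_ge y (k ^ (L + Nat.card S)) with hy | hy
    · exact ⟨y, hy, rfl⟩
    obtain ⟨z, hz, hzy⟩ := hF.exists_lt_of_pow_add_card_le hk hx hy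
    obtain ⟨y', hy', hyz⟩ := ih z hz
    exact ⟨y', hy', hyz.trans hzy⟩

end DigitInvariant

/-- `P` is recognized by an automaton with at most `c` states reading base-`k` digits in
parallel. -/
def Recognizable (k c : ℕ) {r : ℕ} (P : (Fin r → ℕ) → Prop) : Prop :=
  ∃ (S : Type) (_ : Finite S) (F : (Fin r → ℕ) → S),
    Nat.card S ≤ c ∧ DigitInvariant k F ∧ Function.FactorsThrough P F

namespace Recognizable

variable {k c c' r : ℕ}

theorem not {P : (Fin r → ℕ) → Prop} (h : Recognizable k c P) :
    Recognizable k c fun x => ¬P x := by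
  obtain ⟨S, hS, F, hc, hF, hP⟩ := h
  exact ⟨S, hS, F, hc, hF, hP.comp_left Not⟩

theorem and {P P' : (Fin r → ℕ) → Prop} (h : Recognizable k c P) (h' : Recognizable k c' P') :
    Recognizable k (c * c') fun x => P x ∧ P' x := by
  obtain ⟨S, hS, F, hc, hF, hP⟩ := h
  obtain ⟨S', hS', F', hc', hF', hP'⟩ := h'
  refine ⟨S × S', inferInstance, _, ?_, hF.prodMk hF', fun x y hxy => ?_⟩
  · rw [Nat.card_prod]
    exact Nat.mul_le_mul hc hc'
  · exact congrArg₂ And (hP (congrArg Prod.fst hxy)) (hP' (congrArg Prod.snd hxy))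

/-- The subset construction: the state on `x` is the set of states reached on `(y, x)` as `y`
varies, leading zeros allowing `y` to be longer than `x`. -/
theorem exists_cons {P : (Fin (r + 1) → ℕ) → Prop} (hk : 0 < k) (h : Recognizable k c P) :
    Recognizable k (2 ^ c) fun x => ∃ y, P (Matrix.vecCons y x) := by
  obtain ⟨S, hS, F, hc, hF, hP⟩ := h
  refine ⟨Set S, inferInstance, _, ?_, hF.range hk, fun x x' hxx' => propext ?_⟩
  · have := Fintype.ofFinite S
    rw [Nat.card_eq_fintype_card, Fintype.card_set, ← Nat.card_eq_fintype_card]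
    exact Nat.pow_le_pow_right two_pos hc
  · have exists_of_subset : ∀ x x' : Fin r → ℕ, (Set.range fun y => F (Matrix.vecCons y x)) ⊆
        (Set.range fun y => F (Matrix.vecCons y x')) →
        (∃ y, P (Matrix.vecCons y x)) → ∃ y, P (Matrix.vecCons y x') := by
      rintro x x' hsub ⟨y, hy⟩
      obtain ⟨y', hy'⟩ := hsub ⟨y, rfl⟩
      exact ⟨y', (hP hy').mpr hy⟩
    exact ⟨exists_of_subset x x' hxx'.subset, exists_of_subset x' x hxx'.superset⟩

theorem exists_iff_exists_lt {P : (Fin (r + 1) → ℕ) → Prop} (hk : 2 ≤ k)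
    (h : Recognizable k c P) {L : ℕ} {x : Fin r → ℕ} (hx : ∀ v, x v < k ^ L) :
    (∃ y, P (Matrix.vecCons y x)) ↔ ∃ y < k ^ (L + c), P (Matrix.vecCons y x) := by
  obtain ⟨S, hS, F, hc, hF, hP⟩ := h
  refine ⟨fun ⟨y, hy⟩ => ?_, fun ⟨y, _, hy⟩ => ⟨y, hy⟩⟩
  obtain ⟨y', hy', hyy'⟩ := hF.exists_lt_pow_add_card hk hx y
  exact ⟨y', hy'.trans_le (Nat.pow_le_pow_right (by omega) (by omega)), (hP hyy').mpr hy⟩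

end Recognizable

theorem clamp_mul_add_congr {k B z z' e : ℤ} (he : |e| + B ≤ k * B) (hk : 0 ≤ k)
    (h : max (-B) (min B z) = max (-B) (min B z')) :
    max (-B) (min B (k * z + e)) = max (-B) (min B (k * z' + e)) := by
  have saturate_above : ∀ {w}, B ≤ w → B ≤ k * w + e := fun hw => by
    linarith [neg_abs_le e, mul_le_mul_of_nonneg_left hw hk]
  have saturate_below : ∀ {w}, w ≤ -B → k * w + e ≤ -B := fun hw => by
    linarith [le_abs_self e, mul_le_mul_of_nonneg_left hw hk]
  rcases eq_or_ne z z' with rfl | hne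
  · rfl
  by_cases hz : B ≤ z
  · have := saturate_above hz
    have := @saturate_above z'
    have := @saturate_below z'
    omega
  · have := @saturate_below z
    have := @saturate_below z'
    have := @saturate_above z'
    omega

/-- Reading a digit sends the value `z` of the linear form to `k * z + e` with `e` bounded, so once
`|z|` is large its sign never changes again and it is enough to remember `z` clamped to a bounded
interval. -/
theorem exists_recognizable_sum_pos {k r : ℕ} (hk : 0 < k) (a : Fin r → ℤ) :
    ∃ c, Recognizable k c fun x : Fin r → ℕ => 0 < ∑ v, a v * (x v : ℤ) := by
  set B : ℤ := ∑ v, |a v| + 1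
  have hB : 0 < B := by positivity
  let F : (Fin r → ℕ) → Set.Icc (-B) B :=
    fun x => Set.projIcc (-B) B (by omega) (∑ v, a v * (x v : ℤ))
  refine ⟨_, Set.Icc (-B) B, inferInstance, F, le_rfl, fun d hd x y hxy => ?_, fun x y hxy => ?_⟩
  · have sum_digit : ∀ x : Fin r → ℕ, ∑ v, a v * ((k • x + d) v : ℤ) =
        k * ∑ v, a v * (x v : ℤ) + ∑ v, a v * (d v : ℤ) := fun x => by
      rw [Finset.mul_sum, ← Finset.sum_add_distrib]
      refine Finset.sum_congr rfl fun v _ => ?_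
      simp only [Pi.add_apply, Pi.smul_apply, smul_eq_mul]
      push_cast
      ring
    have digit_le : |∑ v, a v * (d v : ℤ)| + B ≤ k * B := by
      have := calc |∑ v, a v * (d v : ℤ)| ≤ ∑ v, |a v * (d v : ℤ)| := Finset.abs_sum_le_sum_abs _ _
        _ ≤ ∑ v, |a v| * (k - 1 : ℤ) := Finset.sum_le_sum fun v _ => by
          rw [abs_mul, Nat.abs_cast]
          have := hd v
          gcongr
          omega
        _ = (∑ v, |a v|) * (k - 1) := (Finset.sum_mul ..).symm
      have : (1 : ℤ) ≤ k := by exact_mod_cast hk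
      simp only [B]
      linarith
    simp only [F, Subtype.ext_iff, Set.coe_projIcc, sum_digit] at hxy ⊢
    exact clamp_mul_add_congr digit_le (by positivity) hxy
  · simp only [F, Subtype.ext_iff, Set.coe_projIcc] at hxy
    refine propext ?_
    omega

theorem primrec_pow : Primrec₂ ((· ^ ·) : ℕ → ℕ → ℕ) :=
  Primrec₂.unpaired'.1 Nat.Primrec.pow

theorem primrec_finset_sum {α ι : Type*} [Primcodable α] {f : ι → α → ℕ} (s : Finset ι)
    (hf : ∀ i, Primrec (f i)) : Primrec fun a => ∑ i ∈ s, f i a := by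
  classical
  induction s using Finset.induction_on with
  | empty => simpa using Primrec.const 0
  | insert i s hi ih => simpa only [Finset.sum_insert hi] using Primrec.nat_add.comp (hf i) ih

theorem primrec_apply {r : ℕ} (v : Fin r) : Primrec fun x : Fin r → ℕ => x v :=
  Primrec.fin_app.comp Primrec.id (Primrec.const v)

theorem primrec_vecCons {r : ℕ} :
    Primrec₂ (Matrix.vecCons : ℕ → (Fin r → ℕ) → Fin (r + 1) → ℕ) := by
  refine Primrec.fin_curry.2 (Primrec.fin_curry₁.2 fun v => ?_).swap
  cases v using Fin.cases with
  | zero => exact Primrec.fst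
  | succ v => exact (primrec_apply v).comp Primrec.snd

theorem primrec_dotProduct {r : ℕ} (a : Fin r → ℕ) : Primrec fun x : Fin r → ℕ => a ⬝ᵥ x :=
  primrec_finset_sum _ fun v => Primrec.nat_mul.comp (Primrec.const (a v)) (primrec_apply v)

/-- A family of predicates which is primitive recursive in the parameter and the arguments, and
whose members are recognized by automata with a primitive recursive bound on the number of states.
The bound makes the family closed under unbounded quantifiers. -/
structure EffectivelyRecognizable (k : ℕ) {α : Type*} [Primcodable α] {r : ℕ}
    (P : α → (Fin r → ℕ) → Prop) : Prop where
  primrecRel : PrimrecRel P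
  recognizable : ∃ c : α → ℕ, Primrec c ∧ ∀ a, Recognizable k (c a) (P a)

namespace EffectivelyRecognizable

variable {k : ℕ} {α : Type*} [Primcodable α] {r : ℕ}

theorem of_eq {P P' : α → (Fin r → ℕ) → Prop} (h : EffectivelyRecognizable k P)
    (hP : ∀ a x, P a x ↔ P' a x) : EffectivelyRecognizable k P' :=
  funext₂ (fun a x => propext (hP a x)) ▸ h

theorem not {P : α → (Fin r → ℕ) → Prop} (h : EffectivelyRecognizable k P) :
    EffectivelyRecognizable k fun a x => ¬P a x := by
  obtain ⟨hP, c, hc, hrec⟩ := h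
  exact ⟨hP.not, c, hc, fun a => (hrec a).not⟩

theorem and {P P' : α → (Fin r → ℕ) → Prop} (h : EffectivelyRecognizable k P)
    (h' : EffectivelyRecognizable k P') : EffectivelyRecognizable k fun a x => P a x ∧ P' a x := by
  obtain ⟨hP, c, hc, hrec⟩ := h
  obtain ⟨hP', c', hc', hrec'⟩ := h'
  exact ⟨PrimrecPred.and hP hP', _, Primrec.nat_mul.comp hc hc', fun a => (hrec a).and (hrec' a)⟩

theorem imp {P P' : α → (Fin r → ℕ) → Prop} (h : EffectivelyRecognizable k P)
    (h' : EffectivelyRecognizable k P') : EffectivelyRecognizable k fun a x => P a x → P' a x :=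
  (h.and h'.not).not.of_eq fun _ _ => not_and_not_right

theorem exists_cons {P : α → (Fin (r + 1) → ℕ) → Prop} (hk : 2 ≤ k)
    (h : EffectivelyRecognizable k P) :
    EffectivelyRecognizable k fun a x => ∃ y, P a (Matrix.vecCons y x) := by
  obtain ⟨hP, c, hc, hrec⟩ := h
  refine ⟨?_, _, primrec_pow.comp (Primrec.const 2) hc, fun a => (hrec a).exists_cons (by omega)⟩
  have hbody : PrimrecRel fun (y : ℕ) (p : α × (Fin r → ℕ)) => P p.1 (Matrix.vecCons y p.2) :=
    hP.comp (Primrec.fst.comp Primrec.snd)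
      (primrec_vecCons.comp Primrec.fst (Primrec.snd.comp Primrec.snd))
  have hbound : Primrec fun p : α × (Fin r → ℕ) => k ^ (∑ v, p.2 v + c p.1) :=
    primrec_pow.comp (Primrec.const k) (Primrec.nat_add.comp
      (primrec_finset_sum _ fun v => (primrec_apply v).comp Primrec.snd) (hc.comp Primrec.fst))
  refine (hbody.exists_mem_list.comp (Primrec.list_range.comp hbound) Primrec.id).of_eq
    fun p => ?_
  simp only [List.mem_range, id]
  refine ((hrec p.1).exists_iff_exists_lt hk fun v => (Nat.lt_pow_self hk).trans_le ?_).symm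
  exact Nat.pow_le_pow_right (by omega)
    (Finset.single_le_sum (fun _ _ => Nat.zero_le _) (Finset.mem_univ v))

theorem forall_cons {P : α → (Fin (r + 1) → ℕ) → Prop} (hk : 2 ≤ k)
    (h : EffectivelyRecognizable k P) :
    EffectivelyRecognizable k fun a x => ∀ y, P a (Matrix.vecCons y x) :=
  (h.not.exists_cons hk).not.of_eq fun _ _ => not_exists_not

theorem primrecPred {P : α → (Fin 0 → ℕ) → Prop} (h : EffectivelyRecognizable k P) :
    PrimrecPred fun a => P a ![] :=
  h.primrecRel.comp Primrec.id (Primrec.const ![])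

theorem dotProduct_lt (hk : 0 < k) (a b : Fin r → ℕ) :
    EffectivelyRecognizable k fun (_ : α) x => a ⬝ᵥ x < b ⬝ᵥ x := by
  obtain ⟨c, hc⟩ := exists_recognizable_sum_pos hk fun v => (b v - a v : ℤ)
  refine ⟨Primrec.nat_lt.comp ((primrec_dotProduct a).comp Primrec.snd)
    ((primrec_dotProduct b).comp Primrec.snd), fun _ => c, Primrec.const c, fun _ => ?_⟩
  convert hc using 2 with x
  simp only [sub_mul, Finset.sum_sub_distrib, sub_pos, dotProduct]
  norm_cast

theorem lt (hk : 0 < k) (u v : Fin r) : EffectivelyRecognizable k fun (_ : α) x => x u < x v :=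
  (dotProduct_lt hk (Pi.single u 1) (Pi.single v 1)).of_eq fun _ _ => by
    simp only [single_one_dotProduct]

theorem lt_add (hk : 0 < k) (u v w : Fin r) :
    EffectivelyRecognizable k fun (_ : α) x => x u < x v + x w :=
  (dotProduct_lt hk (Pi.single u 1) (Pi.single v 1 + Pi.single w 1)).of_eq fun _ _ => by
    simp only [single_one_dotProduct, add_dotProduct]

theorem eq_add (hk : 0 < k) (u v w : Fin r) :
    EffectivelyRecognizable k fun (_ : α) x => x u = x v + x w :=
  ((lt_add hk u v w).not.and
    (dotProduct_lt hk (Pi.single v 1 + Pi.single w 1) (Pi.single u 1)).not).of_eq fun _ _ => by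
      simp only [single_one_dotProduct, add_dotProduct]
      omega

end EffectivelyRecognizable

namespace DFAO

section

variable {k : ℕ} [NeZero k] {Δ : Type*}

/-- The state reached on the canonical representation of `n`. -/
def stateAt (M : DFAO k Δ) (n : ℕ) : Fin M.numStates :=
  M.run (canonicalRep k n)

theorem stateAt_zero (M : DFAO k Δ) : M.stateAt 0 = M.start := by
  simp [stateAt, run, canonicalRep]

theorem stateAt_mul_add (M : DFAO k Δ) (hk : 2 ≤ k) {n d : ℕ} (hd : d < k) (h : d ≠ 0 ∨ n ≠ 0) :
    M.stateAt (k * n + d) = M.step (M.stateAt n) (Fin.ofNat k d) := by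
  simp [stateAt, run, canonicalRep, add_comm (k * n), Nat.digits_add k hk d n hd h]

theorem stateAt_of_ne_zero (M : DFAO k Δ) (hk : 2 ≤ k) {n : ℕ} (hn : n ≠ 0) :
    M.stateAt n = M.step (M.stateAt (n / k)) (Fin.ofNat k (n % k)) := by
  have hne : n % k ≠ 0 ∨ n / k ≠ 0 := by
    by_contra! h
    simpa [h, hn.symm] using Nat.div_add_mod n k
  simpa only [Nat.div_add_mod] using M.stateAt_mul_add hk (Nat.mod_lt n (by omega)) hne

/-- The state alone does not determine the next one: on `0` the automaton has read nothing, and a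
further digit `0` is a leading zero that it skips. -/
theorem digitInvariant_stateAt (M : DFAO k Δ) (hk : 2 ≤ k) {r : ℕ} (u : Fin r) :
    DigitInvariant k fun x => (M.stateAt (x u), x u = 0) := by
  intro d hd x y h
  simp only [Prod.mk.injEq, eq_iff_iff, Pi.add_apply, Pi.smul_apply, smul_eq_mul] at h ⊢
  obtain ⟨hstate, hzero⟩ := h
  refine ⟨?_, by simp [NeZero.ne k, hzero]⟩
  by_cases hx : d u ≠ 0 ∨ x u ≠ 0
  · have hy : d u ≠ 0 ∨ y u ≠ 0 := hx.imp_right hzero.not.1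
    rw [M.stateAt_mul_add hk (hd u) hx, M.stateAt_mul_add hk (hd u) hy, hstate]
  · push Not at hx
    rw [hx.2, hzero.1 hx.2]

theorem recognizable_sequence_eq (M M' : DFAO k Δ) (hk : 2 ≤ k) {r : ℕ} (u v : Fin r) :
    Recognizable k ((M.numStates * 2) * (M'.numStates * 2))
      fun x => M.sequence (x u) = M'.sequence (x v) := by
  refine ⟨_, inferInstance, _, ?_,
    (M.digitInvariant_stateAt hk u).prodMk (M'.digitInvariant_stateAt hk v), fun x y h => ?_⟩
  · simp
  · simp only [Prod.mk.injEq] at h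
    exact congrArg₂ (M.output · = M'.output ·) h.1.1 h.2.1

end

section

variable {k : ℕ} {Δ : Type*}

theorem description_getElem? (M : DFAO k Δ) (q : Fin M.numStates) :
    M.description.2[(q : ℕ)]? = some (M.output q, fun d => (M.step q d : ℕ)) := by
  simp [description]

variable [Primcodable Δ]

theorem primrec_description : Primrec (description : DFAO k Δ → _) := by
  let _ : Primcodable {c : ℕ × List (Δ × (Fin k → ℕ)) // Valid c} :=
    Primcodable.subtype primrecPred_valid
  have hequiv : Primrec (equivDescription : DFAO k Δ ≃ _) := Primrec.of_equiv
  exact (Primrec.subtype_val (hp := primrecPred_valid)).comp hequiv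

theorem primrec_numStates : Primrec (numStates : DFAO k Δ → ℕ) :=
  (Primrec.list_length.comp (Primrec.snd.comp primrec_description)).of_eq fun M => by
    simp [description]

theorem primrec_row : Primrec₂ fun (M : DFAO k Δ) (q : ℕ) => M.description.2[q]? :=
  Primrec.list_getElem?.comp (Primrec.snd.comp (primrec_description.comp Primrec.fst)) Primrec.snd

variable [NeZero k]

theorem primrec_stateAt (hk : 2 ≤ k) :
    Primrec₂ fun (M : DFAO k Δ) (n : ℕ) => (M.stateAt n : ℕ) := by
  have hdigit : Primrec fun n : ℕ => Fin.ofNat k (n % k) :=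
    Primrec.fin_val_iff.1 ((Primrec.nat_mod.comp (Primrec.nat_mod.comp Primrec.id
      (Primrec.const k)) (Primrec.const k)))
  have hlength : Primrec fun x : DFAO k Δ × List ℕ => x.2.length :=
    Primrec.list_length.comp Primrec.snd
  have hsuccessor : Primrec₂ fun (x : DFAO k Δ × List ℕ) (q : ℕ) =>
      (x.1.description.2[q]?).map fun row => row.2 (Fin.ofNat k (x.2.length % k)) :=
    Primrec.option_map (primrec_row.comp (Primrec.fst.comp Primrec.fst) Primrec.snd)
      (Primrec.fin_app.comp (Primrec.snd.comp Primrec.snd)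
        (hdigit.comp (hlength.comp (Primrec.fst.comp Primrec.fst))))
  -- `l` lists the states on `0, …, l.length - 1`.
  have hnext : Primrec₂ fun (M : DFAO k Δ) (l : List ℕ) =>
      if l.length = 0 then some M.description.1 else
        (l[l.length / k]?).bind fun q =>
          (M.description.2[q]?).map fun row => row.2 (Fin.ofNat k (l.length % k)) :=
    Primrec.ite (Primrec.eq.comp hlength (Primrec.const 0))
      (Primrec.option_some.comp (Primrec.fst.comp (primrec_description.comp Primrec.fst)))
      (Primrec.option_bind (Primrec.list_getElem?.comp Primrec.snd
        (Primrec.nat_div.comp hlength (Primrec.const k))) hsuccessor)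
  refine Primrec.nat_strong_rec _ hnext fun M n => ?_
  rcases Nat.eq_zero_or_pos n with rfl | hn
  · simp [stateAt_zero, description]
  · have hlt : n / k < n := Nat.div_lt_self hn hk
    simp [hn.ne', hlt, description_getElem?, M.stateAt_of_ne_zero hk hn.ne']

theorem primrec_sequence (hk : 2 ≤ k) :
    Primrec₂ fun (M : DFAO k Δ) (n : ℕ) => M.sequence n := by
  refine Primrec.option_some_iff.1 ?_
  refine (Primrec.option_map (primrec_row.comp Primrec.fst (primrec_stateAt hk))
    (Primrec.fst.comp Primrec.snd).to₂).of_eq fun x => ?_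
  rw [description_getElem?]
  rfl

theorem effectivelyRecognizable_sequence_eq (hk : 2 ≤ k) {r : ℕ} (u v : Fin r) :
    EffectivelyRecognizable k fun (P : DFAO k Δ × DFAO k Δ) x =>
      P.1.sequence (x u) = P.2.sequence (x v) where
  primrecRel := Primrec.eq.comp
    ((primrec_sequence hk).comp (Primrec.fst.comp Primrec.fst)
      ((primrec_apply u).comp Primrec.snd))
    ((primrec_sequence hk).comp (Primrec.snd.comp Primrec.fst)
      ((primrec_apply v).comp Primrec.snd))
  recognizable := by
    have hcard : Primrec fun M : DFAO k Δ => M.numStates * 2 :=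
      Primrec.nat_mul.comp primrec_numStates (Primrec.const 2)
    exact ⟨_, Primrec.nat_mul.comp (hcard.comp Primrec.fst) (hcard.comp Primrec.snd),
      fun P => P.1.recognizable_sequence_eq P.2 hk u v⟩

theorem effectivelyRecognizable_sequence_add_eq (hk : 2 ≤ k) {r : ℕ} (u v w : Fin r) :
    EffectivelyRecognizable k fun (P : DFAO k Δ × DFAO k Δ) x =>
      P.1.sequence (x u + x w) = P.2.sequence (x v + x w) := by
  have hk0 : 0 < k := by omega
  -- The automata read the sums from two auxiliary variables `1` and `0`.
  refine ((((EffectivelyRecognizable.eq_add hk0 1 u.succ.succ w.succ.succ).and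
    (.eq_add hk0 0 v.succ.succ w.succ.succ)).and
      (effectivelyRecognizable_sequence_eq hk 1 0)).exists_cons hk |>.exists_cons hk).of_eq
        fun P x => ?_
  simp [and_assoc]

theorem effectivelyRecognizable_forall_lt_sequence_add_eq (hk : 2 ≤ k) {r : ℕ} (u v w : Fin r) :
    EffectivelyRecognizable k fun (P : DFAO k Δ × DFAO k Δ) x =>
      ∀ t < x w, P.1.sequence (x u + t) = P.2.sequence (x v + t) :=
  ((EffectivelyRecognizable.lt (by omega) 0 w.succ).imp
    (effectivelyRecognizable_sequence_add_eq hk u.succ v.succ 0)).forall_cons hk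

end

end DFAO

section Factors

variable {Δ : Type*} {a b : ℕ → Δ}

theorem length_factorAt (a : ℕ → Δ) (i n : ℕ) : (factorAt a i n).length = n := by
  simp [factorAt]

theorem factorAt_eq_factorAt_iff {i j n : ℕ} :
    factorAt a i n = factorAt b j n ↔ ∀ t < n, a (i + t) = b (j + t) := by
  simp [factorAt]

theorem forall_mem_factorSet {p : List Δ → Prop} :
    (∀ w ∈ factorSet a, p w) ↔ ∀ i n, p (factorAt a i n) :=
  ⟨fun h i n => h _ ⟨i, n, rfl⟩, fun h _ ⟨i, n, hw⟩ => hw ▸ h i n⟩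

theorem mem_occurrences_factorAt {i j n : ℕ} :
    j ∈ occurrences b (factorAt a i n) ↔ ∀ t < n, a (i + t) = b (j + t) := by
  rw [occurrences, Set.mem_ofPred_eq, length_factorAt, eq_comm, factorAt_eq_factorAt_iff]

theorem mem_factorSet_iff_nonempty_occurrences {w : List Δ} :
    w ∈ factorSet b ↔ (occurrences b w).Nonempty :=
  ⟨fun ⟨j, n, h⟩ => ⟨j, by subst h; rw [mem_occurrences_factorAt]; exact fun _ _ => rfl⟩,
    fun ⟨j, h⟩ => ⟨j, w.length, h⟩⟩

theorem factorSet_subset_iff :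
    factorSet a ⊆ factorSet b ↔ ∀ i n, ∃ j, ∀ t < n, a (i + t) = b (j + t) := by
  rw [Set.subset_def, forall_mem_factorSet]
  simp only [mem_factorSet_iff_nonempty_occurrences, Set.Nonempty, mem_occurrences_factorAt]

theorem infinite_iff_forall_exists_ge {s : Set ℕ} : s.Infinite ↔ ∀ m, ∃ j ≥ m, j ∈ s :=
  Nat.frequently_atTop_iff_infinite.symm.trans Filter.frequently_atTop

theorem infinite_and_gaps_le_iff_exists_mem_window {s : Set ℕ} :
    (s.Infinite ∧ ∃ t : ℕ, ∀ i ∈ s, ∀ j ∈ s, i < j → (∀ m ∈ s, ¬(i < m ∧ m < j)) → j - i ≤ t) ↔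
      ∃ T, ∀ m, ∃ j ≥ m, j < m + T ∧ j ∈ s := by
  classical
  simp only [infinite_iff_forall_exists_ge]
  constructor
  · rintro ⟨hinf, t, hgap⟩
    obtain ⟨i₀, -, hi₀⟩ := hinf 0
    refine ⟨i₀ + t + 1, fun m => ?_⟩
    induction m with
    | zero => exact ⟨i₀, by omega, by omega, hi₀⟩
    | succ m ih =>
      obtain ⟨j, hmj, hj, hjs⟩ := ih
      rcases hmj.lt_or_eq with hlt | rfl
      · exact ⟨j, hlt, by omega, hjs⟩
      have hnext := hinf (m + 1)
      obtain ⟨hlt, hmem⟩ := Nat.find_spec hnext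
      have := hgap m hjs _ hmem hlt fun l hl hml => Nat.find_min hnext hml.2 ⟨hml.1, hl⟩
      exact ⟨Nat.find hnext, hlt, by omega, hmem⟩
  · rintro ⟨T, hT⟩
    refine ⟨fun m => (hT m).imp fun j hj => ⟨hj.1, hj.2.2⟩, T, fun i _ j _ _ hgap => ?_⟩
    obtain ⟨m, him, hmT, hm⟩ := hT (i + 1)
    have := hgap m hm
    omega

theorem isRecurrent_iff :
    IsRecurrent a ↔ ∀ i n m, ∃ j ≥ m, ∀ t < n, a (i + t) = a (j + t) := by
  rw [IsRecurrent, forall_mem_factorSet]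
  simp only [infinite_iff_forall_exists_ge, mem_occurrences_factorAt]

theorem isUniformlyRecurrent_iff :
    IsUniformlyRecurrent a ↔
      ∀ i n, ∃ T, ∀ m, ∃ j ≥ m, j < m + T ∧ ∀ t < n, a (i + t) = a (j + t) := by
  rw [IsUniformlyRecurrent, forall_mem_factorSet]
  refine forall₂_congr fun i n => ?_
  rw [infinite_and_gaps_le_iff_exists_mem_window]
  simp only [mem_occurrences_factorAt]

end Factors

section Decidability

variable {k : ℕ} [NeZero k] {Δ : Type*} [Primcodable Δ]

theorem primrecPred_factorSet_subset (hk : 2 ≤ k) :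
    PrimrecPred fun P : DFAO k Δ × DFAO k Δ =>
      factorSet P.1.sequence ⊆ factorSet P.2.sequence := by
  have hmatch : EffectivelyRecognizable k fun (P : DFAO k Δ × DFAO k Δ) (x : Fin 3 → ℕ) =>
      ∀ t < x 1, P.1.sequence (x 2 + t) = P.2.sequence (x 0 + t) :=
    DFAO.effectivelyRecognizable_forall_lt_sequence_add_eq hk 2 0 1
  exact (hmatch.exists_cons hk |>.forall_cons hk |>.forall_cons hk).primrecPred.of_eq
    fun _ => factorSet_subset_iff.symm

theorem primrecPred_factorSet_eq (hk : 2 ≤ k) :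
    PrimrecPred fun P : DFAO k Δ × DFAO k Δ =>
      factorSet P.1.sequence = factorSet P.2.sequence :=
  ((primrecPred_factorSet_subset hk).and
    ((primrecPred_factorSet_subset hk).comp (Primrec.snd.pair Primrec.fst))).of_eq
      fun _ => Set.Subset.antisymm_iff.symm

theorem primrecPred_isRecurrent (hk : 2 ≤ k) :
    PrimrecPred fun M : DFAO k Δ => IsRecurrent M.sequence := by
  have hmatch : EffectivelyRecognizable k fun (P : DFAO k Δ × DFAO k Δ) (x : Fin 4 → ℕ) =>
      x 0 ≥ x 1 ∧ ∀ t < x 2, P.1.sequence (x 3 + t) = P.2.sequence (x 0 + t) :=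
    ((EffectivelyRecognizable.lt (by omega) 0 1).not.and
      (DFAO.effectivelyRecognizable_forall_lt_sequence_add_eq hk 3 0 2)).of_eq
        fun _ _ => and_congr_left' not_lt
  have hsentence := (hmatch.exists_cons hk |>.forall_cons hk |>.forall_cons hk
    |>.forall_cons hk).primrecPred
  exact (hsentence.comp (Primrec.id.pair Primrec.id)).of_eq fun _ => isRecurrent_iff.symm

theorem primrecPred_isUniformlyRecurrent (hk : 2 ≤ k) :
    PrimrecPred fun M : DFAO k Δ => IsUniformlyRecurrent M.sequence := by
  have hk0 : 0 < k := by omega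
  have hmatch : EffectivelyRecognizable k fun (P : DFAO k Δ × DFAO k Δ) (x : Fin 5 → ℕ) =>
      x 0 ≥ x 1 ∧ x 0 < x 1 + x 2 ∧
        ∀ t < x 3, P.1.sequence (x 4 + t) = P.2.sequence (x 0 + t) :=
    ((EffectivelyRecognizable.lt hk0 0 1).not.and ((EffectivelyRecognizable.lt_add hk0 0 1 2).and
      (DFAO.effectivelyRecognizable_forall_lt_sequence_add_eq hk 4 0 3))).of_eq
        fun _ _ => and_congr_left' not_lt
  have hsentence := (hmatch.exists_cons hk |>.forall_cons hk |>.exists_cons hk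
    |>.forall_cons hk |>.forall_cons hk).primrecPred
  exact (hsentence.comp (Primrec.id.pair Primrec.id)).of_eq fun _ => isUniformlyRecurrent_iff.symm

end Decidability

theorem mainTheorem6_general (k : ℕ) [NeZero k] (hk : 2 ≤ k) (Δ : Type*) [Primcodable Δ] :
    PrimrecPred (fun M : DFAO k Δ => IsRecurrent M.sequence) ∧
    PrimrecPred (fun M : DFAO k Δ => IsUniformlyRecurrent M.sequence) ∧
    PrimrecPred (fun P : DFAO k Δ × DFAO k Δ =>
      factorSet P.1.sequence = factorSet P.2.sequence) ∧
    PrimrecPred (fun P : DFAO k Δ × DFAO k Δ =>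
      factorSet P.1.sequence ⊆ factorSet P.2.sequence) :=
  ⟨primrecPred_isRecurrent hk, primrecPred_isUniformlyRecurrent hk, primrecPred_factorSet_eq hk,
    primrecPred_factorSet_subset hk⟩

theorem mainTheorem6 (k : ℕ) [NeZero k] (hk : 2 ≤ k) (Δ : Type*) [Primcodable Δ] :
    ComputablePred (fun M : DFAO k Δ => IsRecurrent M.sequence) ∧
    ComputablePred (fun M : DFAO k Δ => IsUniformlyRecurrent M.sequence) ∧
    ComputablePred (fun P : DFAO k Δ × DFAO k Δ =>
      factorSet P.1.sequence = factorSet P.2.sequence) ∧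
    ComputablePred (fun P : DFAO k Δ × DFAO k Δ =>
      factorSet P.1.sequence ⊆ factorSet P.2.sequence) := by
  obtain ⟨recurrent, uniformlyRecurrent, factorSetEq, factorSetSubset⟩ :=
    mainTheorem6_general k hk Δ
  exact ⟨recurrent.computablePred, uniformlyRecurrent.computablePred, factorSetEq.computablePred,
    factorSetSubset.computablePred⟩
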